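/- For integers $r,n\ge 1$ and a sign $\sigma\in\{1,-1\}$ put $H_n^{(r;\sigma)}=\sum_{k=1}^n \sigma^{k-1}/k^r$, so that $\sigma=1$ gives the generalized harmonic numbers $H_n^{(r)}$ and $\sigma=-1$ the alternating harmonic numbers $\bar H_n^{(r)}$. For integers $i_1,\dots,i_m,q\ge1$ and signs $\sigma_1,\dots,\sigma_{m+1}\in\{1,-1\}$ with $(q,\sigma_{m+1})\ne(1,1)$, the (alternating) Euler sum is $$S(i_1,\dots,i_m,q;\sigma_1,\dots,\sigma_{m+1})=\sum_{n=1}^\infty \sigma_{m+1}^{\,n-1}\,\frac{H_n^{(i_1;\sigma_1)}\cdots H_n^{(i_m;\sigma_m)}}{n^q},$$ and for integers $s_1,\dots,s_k\ge1$ and signs with $(s_1,\sigma_1)\neq(1,1)$ the alternating multiple zeta value is $$\zeta(s_1,\dots,s_k;\sigma_1,\dots,\sigma_k)=\lim_{n\to\infty}\ \sum_{n\ge n_1>n_2>\cdots>n_k\ge1}\frac{\sigma_1^{n_1}\cdots\sigma_k^{n_k}}{n_1^{s_1}\cdots n_k^{s_k}}$$ (the series being understood as the limit of its partial sums). An exponent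 with sign $-1$ is also written with a bar, e.g. $\zeta(\bar s)=\zeta(s;-1)$, $S_{\bar r,2r}=S(r,2r;-1,1)$ and $S_{\bar r^2,\bar r}=S(r,r,r;-1,-1,-1)$. **Corollary.** (1) For all integers $i_1,i_2,q\ge1$ and all signs $\sigma_1,\sigma_2,\sigma_3\in\{1,-1\}$ with $(q,\sigma_3)\ne(1,1)$, all the limits below exist and $$\begin{aligned}S(i_1,i_2,q;\sigma_1,\sigma_2,\sigma_3)=\sigma_1\sigma_2\sigma_3\bigl\{&\zeta(q,i_1+i_2;\sigma_3,\sigma_1\sigma_2)+\zeta(q+i_1+i_2;\sigma_1\sigma_2\sigma_3)\\&+\zeta(q,i_1,i_2;\sigma_3,\sigma_1,\sigma_2)+\zeta(q+i_1,i_2;\sigma_1\sigma_3,\sigma_2)\\&+\zeta(q,i_2,i_1;\sigma_3,\sigma_2,\sigma_1)+\zeta(q+i_2,i_1;\sigma_2\sigma_3,\sigma_1)\bigr\}.\end{aligned}$$ (2) For every integer $r\ge1$, all the limits below exist and $$S_{\bar r^2,\bar r}=S_{\bar r,2r}+\tfrac13\bigl\{\zeta(\overline{3r})-\zeta(\bar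 r)^3\bigr\}.$$ (3) For every odd integer $r\ge1$, the sum $S_{\bar r^2,\bar r}$ is expressible in terms of (alternating) zeta values: it is a polynomial with rational coefficients in the numbers $\zeta(s)$, $s\ge2$, and $\zeta(\bar s)$, $s\ge1$. -/

import Mathlib

open Filter Topology

noncomputable section

namespace EulerSums

/-- Signs are elements of `ℤˣ = {1, -1}`. A string of exponents and signs
`(s₁, …, s_k; σ₁, …, σ_k)` is the list `[(s₁, σ₁), …, (s_k, σ_k)]`; the barred exponent `s̄` is
`(s, -1)` and the unbarred exponent `s` is `(s, 1)`. -/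
abbrev SignedIndex : Type := List (ℕ × ℤˣ)

/-- The alternating multiple harmonic sum
`ζ_n(s₁, …, s_k; σ₁, …, σ_k) = ∑_{n ≥ n₁ > n₂ > ⋯ > n_k ≥ 1} ∏_j σ_j ^ n_j / n_j ^ s_j`,
with value `1` for the empty string, computed by summing over the largest variable `n₁ = m`:
the remaining variables then satisfy `m - 1 ≥ n₂ > ⋯ > n_k ≥ 1`. -/
def altMHS : SignedIndex → ℕ → ℝ
  | [], _ => 1
  | (s, σ) :: l, n =>
      ∑ m ∈ Finset.Icc 1 n, ((σ : ℤ) : ℝ) ^ m / (m : ℝ) ^ s * altMHS l (m - 1)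

/-- The limit that defines the alternating multiple zeta value exists. -/
def AltMZVConverges (l : SignedIndex) : Prop :=
  ∃ x : ℝ, Tendsto (altMHS l) atTop (𝓝 x)

/-- The alternating multiple zeta value
`ζ(s₁, …, s_k; σ₁, …, σ_k) = lim_{n → ∞} ζ_n(s₁, …, s_k; σ₁, …, σ_k)`. -/
def altMZV (l : SignedIndex) : ℝ :=
  limUnder atTop (altMHS l)

/-- `∑_{k=1}^n σ ^ (k - 1) / k ^ r`: the generalized harmonic number `H_n^{(r)}` for `σ = 1` and
the alternating harmonic number, with summand `(-1) ^ (k - 1) / k ^ r`, for `σ = -1`. -/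
def signedHarmonic (r : ℕ) (σ : ℤˣ) (n : ℕ) : ℝ :=
  ∑ k ∈ Finset.Icc 1 n, ((σ : ℤ) : ℝ) ^ (k - 1) / (k : ℝ) ^ r

/-- The partial sum over `1 ≤ n ≤ N` of the (alternating) Euler sum
`S(i₁, …, i_m, q; σ₁, …, σ_m, τ)`, whose `n`-th term is `τ ^ (n - 1) / n ^ q` times the product of
the (alternating) harmonic numbers of order `i_j` and sign `σ_j`; the list is
`[(i₁, σ₁), …, (i_m, σ_m)]`. -/
def eulerPartialSum (l : SignedIndex) (q : ℕ) (τ : ℤˣ) (N : ℕ) : ℝ :=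
  ∑ n ∈ Finset.Icc 1 N, ((τ : ℤ) : ℝ) ^ (n - 1) *
    (l.map fun p => signedHarmonic p.1 p.2 n).prod / (n : ℝ) ^ q

/-- The series of the (alternating) Euler sum converges (possibly only conditionally). -/
def EulerSumConverges (l : SignedIndex) (q : ℕ) (τ : ℤˣ) : Prop :=
  ∃ x : ℝ, Tendsto (eulerPartialSum l q τ) atTop (𝓝 x)

/-- The (alternating) Euler sum `S(i₁, …, i_m, q; σ₁, …, σ_m, τ)`, as the limit of its partial
sums: for `q = 1` and `τ = -1` the series need not converge absolutely. -/
def eulerSum (l : SignedIndex) (q : ℕ) (τ : ℤˣ) : ℝ :=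
  limUnder atTop (eulerPartialSum l q τ)

/-- The set of the zeta values `ζ(s)`, `s ≥ 2`, and the alternating zeta values `ζ(s̄)`, `s ≥ 1`. -/
def altZetaValues : Set ℝ :=
  {x | ∃ (s : ℕ) (σ : ℤˣ), 1 ≤ s ∧ (s, σ) ≠ (1, 1) ∧ x = altMZV [(s, σ)]}

end EulerSums

end

open EulerSums

/-!
Separating the terms with equal indices in a product of harmonic numbers writes each partial sum of
a quadratic Euler sum as six alternating multiple harmonic sums. These sums grow more slowly than
their outermost denominators, so Dirichlet's test gives the limits, even when the outermost
exponent is `1̄`. For the sum with three equal exponents, if `X n` are the partial sums of `x n`,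
then `3 * x n * X n ^ 2 = 3 * x n ^ 2 * X n + (X n ^ 3 - X (n - 1) ^ 3) - x n ^ 3`, and the
cubes of `X` telescope.

For odd exponents there remains a linear Euler sum of odd weight, that is, a double zeta value
`ζ(b, a; τ, σ)` with `a + b` odd. Sum `σ ^ (k - m) * τ ^ m / ((k - m) ^ a * m ^ b)` over all
`m ≠ 0, k` in `ℤ` and then over `k ≥ 1`. On the one hand, the partial fraction
`k / ((k - m) * m) = 1 / m + 1 / (k - m)` reduces `a` and `b` until one of them is `0`, at the cost
of a weight `1 / k ^ c`; then the inner sum is a symmetric sum over `ℤ` of a single power, which is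
`0` or twice a zeta value. On the other hand, summing over `k` first telescopes, and since `a + b`
is odd the contributions of `m` and `-m` combine to `±2 ζ(b, a; τ, σ)` plus products of zeta values.
-/

namespace EulerSums

open SummationFilter

/-- The summand `σ ^ m / m ^ s` of an alternating zeta value, extended to all integers `m`. It is
`0` at `m = 0`, even for `s = 0`, so that sums over punctured integers become sums over `ℤ`. -/
noncomputable def signedPower (s : ℕ) (σ : ℤˣ) (m : ℤ) : ℝ :=
  if m = 0 then 0 else ((σ ^ m : ℤˣ) : ℤ) / (m : ℝ) ^ s

lemma signedPower_zero (s : ℕ) (σ : ℤˣ) : signedPower s σ 0 = 0 := if_pos rfl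

lemma signedPower_natCast_add_one (s : ℕ) (σ : ℤˣ) (n : ℕ) :
    signedPower s σ (n + 1) = ((σ : ℤ) : ℝ) ^ (n + 1) / ((n + 1 : ℕ) : ℝ) ^ s := by
  rw [signedPower, if_neg (by omega), ← Nat.cast_succ, zpow_natCast]
  push_cast
  rfl

lemma signedPower_mul (s t : ℕ) (σ τ : ℤˣ) (m : ℤ) :
    signedPower s σ m * signedPower t τ m = signedPower (s + t) (σ * τ) m := by
  unfold signedPower
  split_ifs
  · exact mul_zero 0
  · rw [mul_zpow, pow_add, Units.val_mul, Int.cast_mul, div_mul_div_comm]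

lemma intCast_mul_signedPower_succ (s : ℕ) (σ : ℤˣ) (m : ℤ) :
    m * signedPower (s + 1) σ m = signedPower s σ m := by
  unfold signedPower
  split_ifs with hm
  · exact mul_zero _
  · have : (m : ℝ) ≠ 0 := Int.cast_ne_zero.2 hm
    field_simp
    ring

lemma signedPower_neg (s : ℕ) (σ : ℤˣ) (m : ℤ) :
    signedPower s σ (-m) = (-1) ^ s * signedPower s σ m := by
  simp only [signedPower, neg_eq_zero, zpow_neg, Int.units_inv_eq_self, Int.cast_neg,
    neg_pow (m : ℝ), mul_ite, mul_zero]
  rcases neg_one_pow_eq_or ℝ s with h | h <;> simp [h, div_neg]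

lemma abs_signedPower_le (s : ℕ) (σ : ℤˣ) (m : ℤ) : |signedPower s σ m| ≤ 1 / |(m : ℝ)| ^ s := by
  unfold signedPower
  split_ifs
  · rw [abs_zero]
    positivity
  · rcases Int.units_eq_one_or (σ ^ m) with h | h <;> simp [h, abs_div]

lemma tendsto_signedPower_cofinite {s : ℕ} (hs : s ≠ 0) (σ : ℤˣ) :
    Tendsto (signedPower s σ) cofinite (𝓝 0) := by
  refine squeeze_zero_norm (abs_signedPower_le s σ) (tendsto_const_nhds.div_atTop ?_)
  refine (tendsto_pow_atTop hs).comp ?_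
  exact (tendsto_norm_cocompact_atTop (E := ℝ)).comp Int.tendsto_coe_cofinite

lemma summable_signedPower {s : ℕ} (hs : 2 ≤ s) (σ : ℤˣ) : Summable (signedPower s σ) := by
  refine .of_norm_bounded (Real.summable_one_div_int_pow.2 hs).abs fun m => ?_
  simpa using abs_signedPower_le s σ m

lemma altMHS_cons (s : ℕ) (σ : ℤˣ) (l : SignedIndex) (n : ℕ) :
    altMHS ((s, σ) :: l) n = ∑ m ∈ Finset.range n, signedPower s σ (m + 1) * altMHS l m := by
  rw [altMHS, ← Finset.Ico_add_one_right_eq_Icc, Finset.sum_Ico_eq_sum_range]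
  simp [signedPower_natCast_add_one, add_comm 1]

lemma altMHS_cons_succ (s : ℕ) (σ : ℤˣ) (l : SignedIndex) (n : ℕ) :
    altMHS ((s, σ) :: l) (n + 1) =
      altMHS ((s, σ) :: l) n + signedPower s σ (n + 1) * altMHS l n := by
  rw [altMHS_cons, Finset.sum_range_succ, ← altMHS_cons]

lemma altMHS_singleton (s : ℕ) (σ : ℤˣ) (n : ℕ) :
    altMHS [(s, σ)] n = ∑ m ∈ Finset.range n, signedPower s σ (m + 1) := by
  simp only [altMHS_cons, altMHS.eq_1, mul_one]

lemma altMHS_singleton_succ (s : ℕ) (σ : ℤˣ) (n : ℕ) :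
    altMHS [(s, σ)] (n + 1) = altMHS [(s, σ)] n + signedPower s σ (n + 1) := by
  rw [altMHS_cons_succ, altMHS.eq_1, mul_one]

lemma AltMZVConverges.tendsto {l : SignedIndex} (h : AltMZVConverges l) :
    Tendsto (altMHS l) atTop (𝓝 (altMZV l)) :=
  tendsto_nhds_limUnder h

section Convergence

theorem exists_tendsto_sum_smul_of_summable_abs_sub {E : Type*} [NormedAddCommGroup E]
    [NormedSpace ℝ E] [CompleteSpace E] {f : ℕ → ℝ} {g : ℕ → E} {B : ℝ}
    (hf : Tendsto f atTop (𝓝 0)) (hf' : Summable fun n => |f (n + 1) - f n|)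
    (hg : ∀ n, ‖∑ i ∈ Finset.range n, g i‖ ≤ B) :
    ∃ x, Tendsto (fun n => ∑ i ∈ Finset.range n, f i • g i) atTop (𝓝 x) := by
  let G n := ∑ i ∈ Finset.range n, g i
  have hsum : Summable fun i => (f (i + 1) - f i) • G (i + 1) :=
    .of_norm_bounded (hf'.mul_right B) fun i => by
      rw [norm_smul, Real.norm_eq_abs]
      exact mul_le_mul_of_nonneg_left (hg _) (abs_nonneg _)
  have hboundary : Tendsto (fun n => f n • G (n + 1)) atTop (𝓝 0) :=
    squeeze_zero_norm
      (fun n => (norm_smul _ _).trans_le (mul_le_mul_of_nonneg_left (hg _) (norm_nonneg _)))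
      (by simpa using hf.norm.mul_const B)
  refine ⟨_, (tendsto_add_atTop_iff_nat 1).1 ((hboundary.sub hsum.hasSum.tendsto_sum_nat).congr
    fun n => ?_)⟩
  rw [Finset.sum_range_by_parts f g (n + 1), Nat.add_sub_cancel]

lemma sum_inv_sqrt_le (n : ℕ) : ∑ m ∈ Finset.range n, (√((m : ℝ) + 1))⁻¹ ≤ 2 * √n := by
  induction n with
  | zero => simp
  | succ n ih =>
    have hn : (0 : ℝ) < √((n : ℝ) + 1) := by positivity
    have hsq : √((n : ℝ) + 1) ^ 2 = √(n : ℝ) ^ 2 + 1 := by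
      rw [Real.sq_sqrt (by positivity), Real.sq_sqrt (by positivity)]
    have hstep : (√((n : ℝ) + 1))⁻¹ ≤ 2 * (√((n : ℝ) + 1) - √(n : ℝ)) := by
      rw [inv_le_iff_one_le_mul₀ hn]
      linarith [sq_nonneg (√((n : ℝ) + 1) - √(n : ℝ))]
    rw [Finset.sum_range_succ, Nat.cast_succ]
    linarith

lemma abs_signedPower_natCast_add_one_le {s t : ℕ} (hts : t ≤ s) (σ : ℤˣ) (n : ℕ) :
    |signedPower s σ (n + 1)| ≤ 1 / ((n : ℝ) + 1) ^ t := by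
  have hn : (1 : ℝ) ≤ (n : ℝ) + 1 := by simp
  calc |signedPower s σ (n + 1)| ≤ 1 / ((n : ℝ) + 1) ^ s := by
        simpa [abs_of_pos (zero_lt_one.trans_le hn)] using abs_signedPower_le s σ (n + 1)
    _ ≤ 1 / ((n : ℝ) + 1) ^ t := by gcongr

lemma abs_altMHS_le {l : SignedIndex} (hl : ∀ p ∈ l, 1 ≤ p.1) (n : ℕ) :
    |altMHS l n| ≤ 2 ^ l.length * √((n : ℝ) + 1) := by
  induction l generalizing n with
  | nil => simp [altMHS]
  | cons p l ih =>
    obtain ⟨hp, hl⟩ := List.forall_mem_cons.1 hl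
    rw [altMHS_cons]
    calc |∑ m ∈ Finset.range n, signedPower p.1 p.2 (m + 1) * altMHS l m|
        ≤ ∑ m ∈ Finset.range n, 2 ^ l.length * (√((m : ℝ) + 1))⁻¹ := by
          refine (Finset.abs_sum_le_sum_abs _ _).trans (Finset.sum_le_sum fun m _ => ?_)
          calc |signedPower p.1 p.2 (m + 1) * altMHS l m|
              ≤ 1 / ((m : ℝ) + 1) ^ 1 * (2 ^ l.length * √((m : ℝ) + 1)) := by
                rw [abs_mul]
                gcongr
                exacts [abs_signedPower_natCast_add_one_le hp p.2 m, ih hl m]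
            _ = 2 ^ l.length * (√((m : ℝ) + 1))⁻¹ := by
                rw [← Real.sqrt_div_self]
                ring
      _ ≤ 2 ^ l.length * (2 * √n) := by
          rw [← Finset.mul_sum]
          gcongr
          exact sum_inv_sqrt_le n
      _ ≤ 2 ^ (l.length + 1) * √((n : ℝ) + 1) := by
          rw [pow_succ, mul_assoc]
          gcongr
          linarith

lemma abs_altMHS_succ_sub_le {l : SignedIndex} (hl : ∀ p ∈ l, 1 ≤ p.1) (n : ℕ) :
    |altMHS l (n + 1) - altMHS l n| ≤ 2 ^ l.length * (√((n : ℝ) + 1) / (n + 1)) := by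
  cases l with
  | nil =>
    simp only [altMHS, sub_self, abs_zero]
    positivity
  | cons p l =>
    obtain ⟨hp, hl⟩ := List.forall_mem_cons.1 hl
    rw [altMHS_cons_succ, add_sub_cancel_left, abs_mul]
    calc |signedPower p.1 p.2 (n + 1)| * |altMHS l n|
        ≤ 1 / ((n : ℝ) + 1) ^ 1 * (2 ^ l.length * √((n : ℝ) + 1)) := by
          gcongr
          exacts [abs_signedPower_natCast_add_one_le hp p.2 n, abs_altMHS_le hl n]
      _ = 2 ^ l.length * (√((n : ℝ) + 1) / (n + 1)) := by ring
      _ ≤ 2 ^ (l.length + 1) * (√((n : ℝ) + 1) / (n + 1)) := by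
          gcongr <;> simp

lemma summable_sqrt_div_sq : Summable fun n : ℕ => √((n : ℝ) + 1) / ((n : ℝ) + 1) ^ 2 := by
  have h := (summable_nat_add_iff 1).2
    (Real.summable_nat_rpow.2 (by norm_num : (-(3 / 2) : ℝ) < -1))
  refine h.congr fun n => ?_
  have : (0 : ℝ) < (n : ℝ) + 1 := by positivity
  rw [Real.sqrt_eq_rpow, ← Real.rpow_natCast, ← Real.rpow_sub this]
  norm_num

lemma tendsto_altMHS_div_atTop {l : SignedIndex} (hl : ∀ p ∈ l, 1 ≤ p.1) :
    Tendsto (fun n : ℕ => altMHS l n / ((n : ℝ) + 1)) atTop (𝓝 0) := by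
  have hsqrt : Tendsto (fun n : ℕ => (√((n : ℝ) + 1))⁻¹) atTop (𝓝 0) :=
    (Real.tendsto_sqrt_atTop.comp
      (tendsto_atTop_add_const_right _ 1 tendsto_natCast_atTop_atTop)).inv_tendsto_atTop
  refine squeeze_zero_norm (fun n => ?_) (by simpa using hsqrt.const_mul (2 ^ l.length))
  rw [norm_div, Real.norm_eq_abs, Real.norm_of_nonneg (by positivity), ← Real.sqrt_div_self,
    ← mul_div_assoc]
  gcongr
  exact abs_altMHS_le hl n

lemma summable_abs_altMHS_div_succ_sub {l : SignedIndex} (hl : ∀ p ∈ l, 1 ≤ p.1) :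
    Summable fun n : ℕ =>
      |altMHS l (n + 1) / (((n + 1 : ℕ) : ℝ) + 1) - altMHS l n / ((n : ℝ) + 1)| := by
  refine .of_nonneg_of_le (fun _ => abs_nonneg _) (fun n => ?_)
    (summable_sqrt_div_sq.mul_left (2 ^ l.length + 2 ^ l.length))
  have hn : (0 : ℝ) < (n : ℝ) + 1 := by positivity
  have hn' : (0 : ℝ) < (n : ℝ) + 2 := by positivity
  calc |altMHS l (n + 1) / (((n + 1 : ℕ) : ℝ) + 1) - altMHS l n / ((n : ℝ) + 1)|
      = |(altMHS l (n + 1) - altMHS l n) / ((n : ℝ) + 2)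
          - altMHS l n / (((n : ℝ) + 1) * ((n : ℝ) + 2))| := by
        congr 1
        push_cast
        rw [add_assoc (n : ℝ), one_add_one_eq_two]
        field_simp
        ring
    _ ≤ |altMHS l (n + 1) - altMHS l n| / ((n : ℝ) + 2)
          + |altMHS l n| / (((n : ℝ) + 1) * ((n : ℝ) + 2)) := by
        refine (abs_sub _ _).trans_eq ?_
        rw [abs_div, abs_div, abs_of_pos hn', abs_of_pos (mul_pos hn hn')]
    _ ≤ 2 ^ l.length * (√((n : ℝ) + 1) / (n + 1)) / ((n : ℝ) + 1)
          + 2 ^ l.length * √((n : ℝ) + 1) / (((n : ℝ) + 1) * ((n : ℝ) + 1)) := by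
        gcongr
        exacts [abs_altMHS_succ_sub_le hl n, one_le_two, abs_altMHS_le hl n, one_le_two]
    _ = (2 ^ l.length + 2 ^ l.length) * (√((n : ℝ) + 1) / ((n : ℝ) + 1) ^ 2) := by
        field_simp

lemma altMZVConverges_cons_of_two_le {s : ℕ} (hs : 2 ≤ s) (σ : ℤˣ) {l : SignedIndex}
    (hl : ∀ p ∈ l, 1 ≤ p.1) : AltMZVConverges ((s, σ) :: l) := by
  have hsum : Summable fun n : ℕ => signedPower s σ (n + 1) * altMHS l n := by
    refine .of_norm_bounded (summable_sqrt_div_sq.mul_left (2 ^ l.length)) fun n => ?_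
    calc |signedPower s σ (n + 1) * altMHS l n|
        ≤ 1 / ((n : ℝ) + 1) ^ 2 * (2 ^ l.length * √((n : ℝ) + 1)) := by
          rw [abs_mul]
          gcongr
          exacts [abs_signedPower_natCast_add_one_le hs σ n, abs_altMHS_le hl n]
      _ = 2 ^ l.length * (√((n : ℝ) + 1) / ((n : ℝ) + 1) ^ 2) := by ring
  exact ⟨_, hsum.hasSum.tendsto_sum_nat.congr fun n => (altMHS_cons s σ l n).symm⟩

lemma altMZVConverges_cons_one_neg_one {l : SignedIndex} (hl : ∀ p ∈ l, 1 ≤ p.1) :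
    AltMZVConverges ((1, -1) :: l) := by
  have hsigns : ∀ n, ‖∑ i ∈ Finset.range n, (-1 : ℝ) ^ (i + 1)‖ ≤ 1 := fun n => by
    simp only [pow_succ, ← Finset.sum_mul, neg_one_geom_sum]
    split_ifs <;> simp
  obtain ⟨x, hx⟩ := exists_tendsto_sum_smul_of_summable_abs_sub (tendsto_altMHS_div_atTop hl)
    (summable_abs_altMHS_div_succ_sub hl) hsigns
  refine ⟨x, hx.congr fun n => ?_⟩
  rw [altMHS_cons]
  refine Finset.sum_congr rfl fun m _ => ?_
  rw [signedPower_natCast_add_one, smul_eq_mul]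
  push_cast
  ring

theorem altMZVConverges_cons {s : ℕ} {σ : ℤˣ} {l : SignedIndex} (hs : 1 ≤ s)
    (hsσ : (s, σ) ≠ (1, 1)) (hl : ∀ p ∈ l, 1 ≤ p.1) : AltMZVConverges ((s, σ) :: l) := by
  rcases hs.eq_or_lt with rfl | hs
  · obtain rfl : σ = -1 := (Int.units_eq_one_or σ).resolve_left fun h => hsσ (by rw [h])
    exact altMZVConverges_cons_one_neg_one hl
  · exact altMZVConverges_cons_of_two_le hs σ hl

lemma altMZVConverges_singleton {s : ℕ} {σ : ℤˣ} (hs : 1 ≤ s) (hsσ : (s, σ) ≠ (1, 1)) :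
    AltMZVConverges [(s, σ)] :=
  altMZVConverges_cons hs hsσ (List.forall_mem_nil _)

end Convergence

section EulerSum

lemma altMHS_singleton_mul_altMHS_singleton (s t : ℕ) (σ τ : ℤˣ) (n : ℕ) :
    altMHS [(s, σ)] n * altMHS [(t, τ)] n =
      altMHS [(s + t, σ * τ)] n + altMHS [(s, σ), (t, τ)] n + altMHS [(t, τ), (s, σ)] n := by
  induction n with
  | zero => simp [altMHS]
  | succ n ih =>
    simp only [altMHS_singleton_succ, altMHS_cons_succ _ _ [_], ← signedPower_mul]
    linear_combination ih

lemma sum_signedPower_mul_altMHS_cons (q s : ℕ) (τ σ : ℤˣ) (l : SignedIndex) (n : ℕ) :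
    ∑ m ∈ Finset.range n, signedPower q τ (m + 1) * altMHS ((s, σ) :: l) (m + 1) =
      altMHS ((q, τ) :: (s, σ) :: l) n + altMHS ((q + s, σ * τ) :: l) n := by
  rw [altMHS_cons q, altMHS_cons (q + s), ← Finset.sum_add_distrib]
  refine Finset.sum_congr rfl fun m _ => ?_
  rw [altMHS_cons_succ, mul_comm σ τ, ← signedPower_mul]
  ring

lemma signedHarmonic_eq (r : ℕ) (σ : ℤˣ) (n : ℕ) :
    signedHarmonic r σ n = (σ : ℤ) * altMHS [(r, σ)] n := by
  rw [signedHarmonic, altMHS, Finset.mul_sum]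
  refine Finset.sum_congr rfl fun k hk => ?_
  obtain ⟨k, rfl⟩ := Nat.exists_eq_add_of_le' (Finset.mem_Icc.1 hk).1
  rcases Int.units_eq_one_or σ with rfl | rfl <;> simp [altMHS, pow_succ, neg_div]

lemma eulerPartialSum_eq (l : SignedIndex) (q : ℕ) (τ : ℤˣ) (n : ℕ) :
    eulerPartialSum l q τ n = (((l.map Prod.snd).prod * τ : ℤˣ) : ℤ) *
      ∑ m ∈ Finset.range n,
        signedPower q τ (m + 1) * (l.map fun p => altMHS [p] (m + 1)).prod := by
  have hprod (k : ℕ) : (l.map fun p => signedHarmonic p.1 p.2 k).prod =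
      (((l.map Prod.snd).prod : ℤˣ) : ℤ) * (l.map fun p => altMHS [p] k).prod := by
    induction l with
    | nil => simp
    | cons p l ih =>
      rw [List.map_cons, List.prod_cons, ih, signedHarmonic_eq]
      simp only [List.map_cons, List.prod_cons, Units.val_mul, Int.cast_mul]
      ring
  rw [eulerPartialSum, ← Finset.Ico_add_one_right_eq_Icc, Finset.sum_Ico_eq_sum_range,
    Finset.mul_sum]
  refine Finset.sum_congr rfl fun m _ => ?_
  rw [hprod, signedPower_natCast_add_one, add_comm 1 m]
  rcases Int.units_eq_one_or τ with rfl | rfl <;> simp [pow_succ] <;> ring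

lemma eulerPartialSum_singleton (s q : ℕ) (σ τ : ℤˣ) (n : ℕ) :
    eulerPartialSum [(s, σ)] q τ n = ((σ * τ : ℤˣ) : ℤ) *
      (altMHS [(q, τ), (s, σ)] n + altMHS [(q + s, σ * τ)] n) := by
  simp only [eulerPartialSum_eq, List.map_cons, List.map_nil, List.prod_singleton,
    sum_signedPower_mul_altMHS_cons]

lemma eulerPartialSum_pair (a b q : ℕ) (σ₁ σ₂ σ₃ : ℤˣ) (n : ℕ) :
    eulerPartialSum [(a, σ₁), (b, σ₂)] q σ₃ n =
      ((σ₁ * σ₂ * σ₃ : ℤˣ) : ℤ) *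
        (altMHS [(q, σ₃), (a + b, σ₁ * σ₂)] n + altMHS [(q + a + b, σ₁ * σ₂ * σ₃)] n
          + altMHS [(q, σ₃), (a, σ₁), (b, σ₂)] n + altMHS [(q + a, σ₁ * σ₃), (b, σ₂)] n
          + altMHS [(q, σ₃), (b, σ₂), (a, σ₁)] n + altMHS [(q + b, σ₂ * σ₃), (a, σ₁)] n) := by
  simp only [eulerPartialSum_eq, List.map_cons, List.map_nil, List.prod_cons, List.prod_nil,
    mul_one, altMHS_singleton_mul_altMHS_singleton, mul_add, Finset.sum_add_distrib,
    sum_signedPower_mul_altMHS_cons, add_assoc]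

lemma three_mul_sum_mul_sq_partialSum {R : Type*} [CommRing R] (x : ℕ → R) (n : ℕ) :
    3 * ∑ m ∈ Finset.range n, x m * (∑ k ∈ Finset.range (m + 1), x k) ^ 2 =
      3 * ∑ m ∈ Finset.range n, x m ^ 2 * ∑ k ∈ Finset.range (m + 1), x k
        + (∑ m ∈ Finset.range n, x m) ^ 3 - ∑ m ∈ Finset.range n, x m ^ 3 := by
  induction n with
  | zero => simp
  | succ n ih =>
    simp only [Finset.sum_range_succ _ n] at ih ⊢
    linear_combination ih

lemma eulerPartialSum_cube (r : ℕ) (σ : ℤˣ) (n : ℕ) :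
    eulerPartialSum [(r, σ), (r, σ)] r σ n = eulerPartialSum [(r, σ)] (2 * r) 1 n
      + (σ : ℤ) / 3 * (altMHS [(r, σ)] n ^ 3 - altMHS [(3 * r, σ)] n) := by
  have hσ : σ * σ = 1 := Int.units_mul_self σ
  have hsq (m : ℤ) : signedPower (2 * r) 1 m = signedPower r σ m ^ 2 := by
    rw [sq, signedPower_mul, two_mul, hσ]
  have hcube (m : ℤ) : signedPower (3 * r) σ m = signedPower r σ m ^ 3 := by
    rw [pow_succ, ← hsq, signedPower_mul, one_mul]
    congr 1
    ring
  have key := three_mul_sum_mul_sq_partialSum (fun m : ℕ => signedPower r σ (m + 1)) n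
  simp only [eulerPartialSum_eq, List.map_cons, List.map_nil, List.prod_cons, List.prod_nil,
    mul_one, hσ, one_mul, ← sq, hsq, altMHS_singleton, hcube]
  linear_combination (σ : ℤ) / 3 * key

end EulerSum

section SymmetricSum

variable {E : Type*} [AddCommGroup E] [TopologicalSpace E] {f : ℤ → E} {x : E}

lemma hasSum_conditional_nat_iff {u : ℕ → E} :
    HasSum u x (conditional ℕ) ↔ Tendsto (fun n => ∑ k ∈ Finset.range n, u k) atTop (𝓝 x) := by
  rw [HasSum, conditional_filter_eq_map_range, tendsto_map'_iff]
  rfl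

lemma hasSum_of_hasSum_unconditional {β : Type*} {u : β → E} (h : HasSum u x)
    (L : SummationFilter β) [L.LeAtTop] : HasSum u x L :=
  Tendsto.mono_left h (by simpa using L.le_atTop)

lemma hasSum_symmetricIcc_of_hasSum_add_neg (h0 : f 0 = 0)
    (h : HasSum (fun n : ℕ => f (n + 1) + f (-(n + 1))) x (conditional ℕ)) :
    HasSum f x (symmetricIcc ℤ) := by
  refine hasSum_symmetricIcc_iff.2 ((hasSum_conditional_nat_iff.1 h).congr fun n => ?_)
  induction n with
  | zero => simp [h0]
  | succ n ih =>
    rw [Finset.sum_range_succ, ih, Nat.cast_succ, Finset.sum_Icc_succ_eq_add_endpoints, add_comm]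

lemma hasSum_symmetricIcc_comp_neg (h : HasSum f x (symmetricIcc ℤ)) :
    HasSum (fun m => f (-m)) x (symmetricIcc ℤ) := by
  refine hasSum_symmetricIcc_iff.2 ((hasSum_symmetricIcc_iff.1 h).congr fun n => ?_)
  exact Finset.sum_equiv (Equiv.neg ℤ) (fun m => by simp; omega) (fun m _ => by simp)

lemma sum_Icc_comp_add_one {E : Type*} [AddCommGroup E] (f : ℤ → E) (n : ℕ) :
    ∑ m ∈ Finset.Icc (-n : ℤ) n, f (m + 1) =
      ∑ m ∈ Finset.Icc (-n : ℤ) n, f m + (f (n + 1) - f (-n)) := by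
  induction n with
  | zero => simp
  | succ n ih =>
    rw [Nat.cast_succ, Finset.sum_Icc_succ_eq_add_endpoints, Finset.sum_Icc_succ_eq_add_endpoints,
      ih, neg_add, neg_add_cancel_right]
    abel

lemma hasSum_symmetricIcc_comp_add_one_iff [IsTopologicalAddGroup E]
    (hf : Tendsto f cofinite (𝓝 0)) :
    HasSum (fun m => f (m + 1)) x (symmetricIcc ℤ) ↔ HasSum f x (symmetricIcc ℤ) := by
  rw [Int.cofinite_eq, tendsto_sup] at hf
  have hright : Tendsto (fun n : ℕ => f (n + 1)) atTop (𝓝 0) :=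
    hf.2.comp (tendsto_atTop_add_const_right _ 1 tendsto_natCast_atTop_atTop)
  have hleft : Tendsto (fun n : ℕ => f (-n)) atTop (𝓝 0) :=
    hf.1.comp (tendsto_neg_atTop_atBot.comp tendsto_natCast_atTop_atTop)
  have hends : Tendsto (fun n : ℕ => f (n + 1) - f (-n)) atTop (𝓝 0) := by
    simpa using hright.sub hleft
  simp only [hasSum_symmetricIcc_iff, sum_Icc_comp_add_one]
  exact ⟨fun h => by simpa using h.sub hends, fun h => by simpa using h.add hends⟩

lemma hasSum_symmetricIcc_comp_add [IsTopologicalAddGroup E] (hf : Tendsto f cofinite (𝓝 0))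
    (h : HasSum f x (symmetricIcc ℤ)) (k : ℤ) :
    HasSum (fun m => f (m + k)) x (symmetricIcc ℤ) := by
  have htail (j : ℤ) : Tendsto (fun m => f (m + j)) cofinite (𝓝 0) :=
    hf.comp (add_left_injective j).tendsto_cofinite
  induction k using Int.induction_on with
  | zero => simpa using h
  | succ k ih =>
    simpa only [add_right_comm, add_assoc] using
      (hasSum_symmetricIcc_comp_add_one_iff (htail k)).2 ih
  | pred k ih =>
    refine (hasSum_symmetricIcc_comp_add_one_iff (htail (-k - 1))).1 ?_
    simpa only [add_assoc, add_sub_cancel] using ih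

lemma hasSum_symmetricIcc_comp_sub [IsTopologicalAddGroup E] (hf : Tendsto f cofinite (𝓝 0))
    (h : HasSum f x (symmetricIcc ℤ)) (k : ℤ) :
    HasSum (fun m => f (k - m)) x (symmetricIcc ℤ) := by
  simpa only [neg_add_eq_sub] using
    hasSum_symmetricIcc_comp_neg (hasSum_symmetricIcc_comp_add hf h k)

lemma sum_range_comp_sub {E : Type*} [AddCommGroup E] {f G : ℤ → E}
    (hG : ∀ z, G (z + 1) = G z + f (z + 1)) (n : ℕ) (m : ℤ) :
    ∑ k ∈ Finset.range n, f (k + 1 - m) = G (n - m) - G (-m) := by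
  induction n with
  | zero => simp
  | succ n ih =>
    rw [Finset.sum_range_succ, ih, Nat.cast_succ, add_sub_right_comm, hG]
    abel

/- The double sum need not converge absolutely, but its partial sums over `n` telescope in the
bounded primitive `G`, so that `w` dominates them and the limit may be taken termwise in `m`. -/
theorem hasSum_conditional_nat_of_hasSum_primitive_mul {f w G : ℤ → ℝ} {g : ℕ → ℝ} {L B y : ℝ}
    (hG : ∀ z, G (z + 1) = G z + f (z + 1)) (hB : ∀ z, |G z| ≤ B) (hL : Tendsto G atTop (𝓝 L))
    (hw : Summable w)
    (hg : ∀ n : ℕ, HasSum (fun m => f (n + 1 - m) * w m) (g n) (symmetricIcc ℤ))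
    (hy : HasSum (fun m => (L - G (-m)) * w m) y (symmetricIcc ℤ)) :
    HasSum g y (conditional ℕ) := by
  let F (n : ℕ) (m : ℤ) : ℝ := (G (n - m) - G (-m)) * w m
  have hF_eq (n : ℕ) (m : ℤ) : F n m = ∑ k ∈ Finset.range n, f (k + 1 - m) * w m := by
    rw [← Finset.sum_mul, sum_range_comp_sub hG]
  have hF_le (n : ℕ) (m : ℤ) : ‖F n m‖ ≤ (B + B) * |w m| := by
    rw [Real.norm_eq_abs, abs_mul]
    gcongr
    exact (abs_sub _ _).trans (add_le_add (hB _) (hB _))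
  have hbound : Summable fun m => (B + B) * |w m| := hw.abs.mul_left _
  have hF_tendsto (m : ℤ) : Tendsto (F · m) atTop (𝓝 ((L - G (-m)) * w m)) :=
    ((hL.comp (tendsto_atTop_add_const_right _ _ tendsto_natCast_atTop_atTop)).sub_const
      _).mul_const _
  have hF_tsum (n : ℕ) : ∑' m, F n m = ∑ k ∈ Finset.range n, g k := by
    refine (hasSum_of_hasSum_unconditional
      (Summable.of_norm_bounded hbound (hF_le n)).hasSum (symmetricIcc ℤ)).unique ?_
    rw [funext (hF_eq n)]
    exact hasSum_sum fun k _ => hg k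
  have hlim_le (m : ℤ) : ‖(L - G (-m)) * w m‖ ≤ (B + B) * |w m| :=
    le_of_tendsto (hF_tendsto m).norm (.of_forall fun n => hF_le n m)
  have hlim_tsum : ∑' m, (L - G (-m)) * w m = y :=
    (hasSum_of_hasSum_unconditional (Summable.of_norm_bounded hbound hlim_le).hasSum
      (symmetricIcc ℤ)).unique hy
  rw [hasSum_conditional_nat_iff, ← hlim_tsum]
  simpa only [hF_tsum] using
    tendsto_tsum_of_dominated_convergence hbound hF_tendsto (.of_forall hF_le)

end SymmetricSum

section Tornheim

/-- The real numbers expressible as rational polynomials in (alternating) zeta values. -/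
noncomputable abbrev altZetaAlgebra : Subalgebra ℚ ℝ := Algebra.adjoin ℚ altZetaValues

lemma altMZV_singleton_mem {s : ℕ} {σ : ℤˣ} (hs : 1 ≤ s) (hsσ : (s, σ) ≠ (1, 1)) :
    altMZV [(s, σ)] ∈ altZetaAlgebra :=
  Algebra.subset_adjoin ⟨s, σ, hs, hsσ, rfl⟩

lemma hasSum_signedPower_mul_altMHS {s : ℕ} {σ : ℤˣ} {l : SignedIndex}
    (h : AltMZVConverges ((s, σ) :: l)) :
    HasSum (fun n : ℕ => signedPower s σ (n + 1) * altMHS l n) (altMZV ((s, σ) :: l))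
      (conditional ℕ) :=
  hasSum_conditional_nat_iff.2 (h.tendsto.congr fun n => altMHS_cons s σ l n)

lemma hasSum_signedPower_natCast_add_one {s : ℕ} {σ : ℤˣ} (hs : 1 ≤ s)
    (hsσ : (s, σ) ≠ (1, 1)) :
    HasSum (fun n : ℕ => signedPower s σ (n + 1)) (altMZV [(s, σ)]) (conditional ℕ) := by
  simpa only [altMHS.eq_1, mul_one] using
    hasSum_signedPower_mul_altMHS (altMZVConverges_singleton hs hsσ)

lemma hasSum_signedPower_of_odd {s : ℕ} (hs : Odd s) (σ : ℤˣ) :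
    HasSum (signedPower s σ) 0 (symmetricIcc ℤ) :=
  hasSum_symmetricIcc_of_hasSum_add_neg (signedPower_zero s σ) <| by
    simpa only [signedPower_neg, hs.neg_one_pow, neg_one_mul, add_neg_cancel] using hasSum_zero

lemma hasSum_signedPower_of_even {s : ℕ} (hs : Even s) (hs0 : s ≠ 0) (σ : ℤˣ) :
    HasSum (signedPower s σ) (2 * altMZV [(s, σ)]) (symmetricIcc ℤ) := by
  have hs2 : 2 ≤ s := by grind
  refine hasSum_symmetricIcc_of_hasSum_add_neg (signedPower_zero s σ) ?_
  simpa only [signedPower_neg, hs.neg_one_pow, one_mul, ← two_mul] using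
    (hasSum_signedPower_natCast_add_one (by omega)
      (ne_of_apply_ne Prod.fst (by omega))).mul_left 2

lemma exists_hasSum_signedPower {s : ℕ} (hs : s ≠ 0) (σ : ℤˣ) :
    ∃ x ∈ altZetaAlgebra, HasSum (signedPower s σ) x (symmetricIcc ℤ) := by
  rcases s.even_or_odd with h | h
  · have hs2 : 2 ≤ s := by grind
    exact ⟨_, mul_mem (ofNat_mem _ 2)
      (altMZV_singleton_mem (by omega) (ne_of_apply_ne Prod.fst (by omega))),
      hasSum_signedPower_of_even h hs σ⟩
  · exact ⟨0, zero_mem _, hasSum_signedPower_of_odd h σ⟩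

lemma signedPower_zero_sub_mul {k : ℤ} (hk : k ≠ 0) (b : ℕ) (σ τ : ℤˣ) (m : ℤ) :
    signedPower 0 σ (k - m) * signedPower b τ m =
      signedPower 0 σ k * signedPower b (σ * τ) m - if m = k then signedPower b τ k else 0 := by
  rcases eq_or_ne m 0 with rfl | hm
  · simp [signedPower_zero, hk.symm]
  rcases eq_or_ne m k with rfl | hmk
  · rw [if_pos rfl, sub_self, signedPower_zero, signedPower_mul, ← mul_assoc,
      Int.units_mul_self, one_mul, zero_add, zero_mul, sub_self]
  · rw [if_neg hmk, sub_zero, ← zero_add b, ← signedPower_mul 0 b, ← mul_assoc, zero_add]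
    congr 1
    simp [signedPower, hk, hm, sub_ne_zero.2 hmk.symm, zpow_sub, Int.units_inv_eq_self]

lemma hasSum_signedPower_zero_sub_mul {k : ℤ} (hk : k ≠ 0) {b : ℕ} {σ τ : ℤˣ} {x : ℝ}
    (hx : HasSum (signedPower b (σ * τ)) x (symmetricIcc ℤ)) :
    HasSum (fun m => signedPower 0 σ (k - m) * signedPower b τ m)
      (signedPower 0 σ k * x - signedPower b τ k) (symmetricIcc ℤ) := by
  simp only [signedPower_zero_sub_mul hk]
  exact (hx.mul_left _).sub (hasSum_ite_eq k _ _)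

lemma tendsto_signedPower_zero_sub_mul_cofinite {k : ℤ} (hk : k ≠ 0) {b : ℕ} (hb : b ≠ 0)
    (σ τ : ℤˣ) :
    Tendsto (fun m => signedPower 0 σ (k - m) * signedPower b τ m) cofinite (𝓝 0) := by
  refine ((tendsto_signedPower_cofinite hb (σ * τ)).const_mul (signedPower 0 σ k)).congr' ?_
    |>.trans (by rw [mul_zero])
  filter_upwards [Set.finite_singleton k |>.compl_mem_cofinite] with m hm
  rw [signedPower_zero_sub_mul hk, if_neg (show m ≠ k from hm), sub_zero]

lemma hasSum_signedPower_sub_mul_zero {k : ℤ} (hk : k ≠ 0) {a : ℕ} (ha : a ≠ 0) {σ τ : ℤˣ}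
    {x : ℝ} (hx : HasSum (signedPower a (τ * σ)) x (symmetricIcc ℤ)) :
    HasSum (fun m => signedPower a σ (k - m) * signedPower 0 τ m)
      (signedPower 0 τ k * x - signedPower a σ k) (symmetricIcc ℤ) := by
  have h := hasSum_symmetricIcc_comp_sub (tendsto_signedPower_zero_sub_mul_cofinite hk ha τ σ)
    (hasSum_signedPower_zero_sub_mul hk hx) k
  simpa only [sub_sub_cancel, mul_comm (signedPower 0 τ _) (signedPower a σ _)] using h

lemma intCast_mul_signedPower_sub_mul (a b : ℕ) (σ τ : ℤˣ) (k m : ℤ) :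
    k * (signedPower (a + 1) σ (k - m) * signedPower (b + 1) τ m) =
      signedPower a σ (k - m) * signedPower (b + 1) τ m
        + signedPower (a + 1) σ (k - m) * signedPower b τ m := by
  rw [← intCast_mul_signedPower_succ a, ← intCast_mul_signedPower_succ b]
  push_cast
  ring

lemma exists_hasSum_signedPower_mul_sub {b c : ℕ} {υ σ τ : ℤˣ} {x : ℝ} (hx : x ∈ altZetaAlgebra)
    (hc : 1 ≤ c) (hcσ : (c, υ * σ) ≠ (1, 1)) (hbcτ : (c + b, υ * τ) ≠ (1, 1)) :
    ∃ y ∈ altZetaAlgebra, HasSum (fun n : ℕ => signedPower c υ (n + 1) *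
      (signedPower 0 σ (n + 1) * x - signedPower b τ (n + 1))) y (conditional ℕ) := by
  refine ⟨_, sub_mem (mul_mem (altMZV_singleton_mem hc hcσ) hx)
    (altMZV_singleton_mem (by omega) hbcτ), ?_⟩
  simp only [mul_sub, ← mul_assoc, signedPower_mul, add_zero]
  exact ((hasSum_signedPower_natCast_add_one hc hcσ).mul_right x).sub
    (hasSum_signedPower_natCast_add_one (by omega) hbcτ)

theorem exists_hasSum_tornheim (a b c : ℕ) (σ τ υ : ℤˣ) (hab : a + b ≠ 0)
    (hca : 1 ≤ c + a) (hcaσ : (c + a, υ * σ) ≠ (1, 1))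
    (hcb : 1 ≤ c + b) (hcbτ : (c + b, υ * τ) ≠ (1, 1)) :
    ∃ g : ℕ → ℝ,
      (∀ n : ℕ, HasSum (fun m => signedPower a σ (n + 1 - m) * signedPower b τ m) (g n)
        (symmetricIcc ℤ)) ∧
      ∃ x ∈ altZetaAlgebra,
        HasSum (fun n : ℕ => signedPower c υ (n + 1) * g n) x (conditional ℕ) := by
  match a, b with
  | 0, b =>
    obtain ⟨x, hx, hxb⟩ := exists_hasSum_signedPower (s := b) (by omega) (σ * τ)
    exact ⟨_, fun n => hasSum_signedPower_zero_sub_mul (by omega) hxb,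
      exists_hasSum_signedPower_mul_sub hx hca hcaσ hcbτ⟩
  | a + 1, 0 =>
    obtain ⟨x, hx, hxa⟩ := exists_hasSum_signedPower (s := a + 1) (by omega) (τ * σ)
    exact ⟨_, fun n => hasSum_signedPower_sub_mul_zero (by omega) (by omega) hxa,
      exists_hasSum_signedPower_mul_sub hx hcb hcbτ hcaσ⟩
  | a + 1, b + 1 =>
    have hca' : c + (a + 1) = c + 1 + a := by omega
    have hcb' : c + (b + 1) = c + 1 + b := by omega
    obtain ⟨g, hg, x, hx, hgx⟩ := exists_hasSum_tornheim a (b + 1) (c + 1) σ τ υ (by omega)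
      (by omega) (by rwa [← hca']) (by omega) (ne_of_apply_ne Prod.fst (by omega))
    obtain ⟨h, hh, y, hy, hhy⟩ := exists_hasSum_tornheim (a + 1) b (c + 1) σ τ υ (by omega)
      (by omega) (ne_of_apply_ne Prod.fst (by omega)) (by omega) (by rwa [← hcb'])
    have hn (n : ℕ) : ((n + 1 : ℤ) : ℝ) ≠ 0 := by norm_cast
    refine ⟨fun n => ((n + 1 : ℤ) : ℝ)⁻¹ * (g n + h n), fun n => ?_, x + y, add_mem hx hy, ?_⟩
    · refine (((hg n).add (hh n)).mul_left _).congr_fun fun m => ?_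
      rw [← intCast_mul_signedPower_sub_mul, inv_mul_cancel_left₀ (hn n)]
    · refine (hgx.add hhy).congr_fun fun n => ?_
      rw [← intCast_mul_signedPower_succ c, ← mul_add]
      field_simp [hn n]
termination_by a + b

end Tornheim

section Parity

/-- The primitive (discrete antiderivative) of `signedPower s σ` on `ℤ` that vanishes at `0`, which
makes sums of `signedPower s σ` over intervals of integers telescope. The values at negative
integers are dictated by `signedPower s σ (-m) = (-1) ^ s * signedPower s σ m`. -/
noncomputable def signedPowerPrimitive (s : ℕ) (σ : ℤˣ) : ℤ → ℝ
  | Int.ofNat n => altMHS [(s, σ)] n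
  | Int.negSucc n => (-1) ^ (s + 1) * altMHS [(s, σ)] n

lemma signedPowerPrimitive_natCast (s : ℕ) (σ : ℤˣ) (n : ℕ) :
    signedPowerPrimitive s σ n = altMHS [(s, σ)] n := rfl

lemma signedPowerPrimitive_zero (s : ℕ) (σ : ℤˣ) : signedPowerPrimitive s σ 0 = 0 :=
  altMHS_singleton s σ 0

lemma signedPowerPrimitive_neg (s : ℕ) (σ : ℤˣ) (n : ℕ) :
    signedPowerPrimitive s σ (-(n + 1)) = (-1) ^ (s + 1) * altMHS [(s, σ)] n := by
  rw [← Int.negSucc_eq]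
  rfl

lemma signedPowerPrimitive_add_one (s : ℕ) (σ : ℤˣ) (z : ℤ) :
    signedPowerPrimitive s σ (z + 1) = signedPowerPrimitive s σ z + signedPower s σ (z + 1) := by
  obtain n | n := z
  · rw [Int.ofNat_eq_natCast, ← Nat.cast_succ, signedPowerPrimitive_natCast,
      signedPowerPrimitive_natCast, altMHS_singleton_succ, Nat.cast_succ]
  · rw [Int.negSucc_eq, signedPowerPrimitive_neg, neg_add, neg_add_cancel_right]
    cases n with
    | zero => simp [signedPowerPrimitive_zero, altMHS_singleton, signedPower_zero]
    | succ n =>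
      rw [Nat.cast_succ, signedPowerPrimitive_neg, altMHS_singleton_succ, signedPower_neg]
      ring

lemma tendsto_signedPowerPrimitive {s : ℕ} {σ : ℤˣ} (h : AltMZVConverges [(s, σ)]) :
    Tendsto (signedPowerPrimitive s σ) atTop (𝓝 (altMZV [(s, σ)])) := by
  rw [← Nat.map_cast_int_atTop, tendsto_map'_iff]
  exact h.tendsto

lemma exists_abs_signedPowerPrimitive_le {s : ℕ} {σ : ℤˣ} (h : AltMZVConverges [(s, σ)]) :
    ∃ B, ∀ z, |signedPowerPrimitive s σ z| ≤ B := by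
  obtain ⟨B, hB⟩ := (Metric.isBounded_range_of_tendsto _ h.tendsto).exists_norm_le
  refine ⟨B, fun z => ?_⟩
  obtain n | n := z
  · exact hB _ ⟨n, rfl⟩
  · simpa [signedPowerPrimitive, abs_mul] using hB _ ⟨n, rfl⟩

lemma hasSum_sub_signedPowerPrimitive_mul {a b : ℕ} (hab : Odd (a + b)) (ha : 1 ≤ a)
    (hb : 2 ≤ b) (σ τ : ℤˣ) (x : ℝ) :
    HasSum (fun m => (x - signedPowerPrimitive a σ (-m)) * signedPower b τ m)
      ((1 + (-1) ^ b) * (x * altMZV [(b, τ)])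
        - (-1) ^ b * (2 * altMZV [(b, τ), (a, σ)] + altMZV [(b + a, τ * σ)]))
      (symmetricIcc ℤ) := by
  have hsign : (-1 : ℝ) ^ (a + 1) = (-1) ^ b := by
    rw [neg_one_pow_congr]
    grind
  have hζ := hasSum_signedPower_natCast_add_one (σ := τ) (by omega : 1 ≤ b)
    (ne_of_apply_ne Prod.fst (by omega))
  have hζ₂ := hasSum_signedPower_mul_altMHS
    (altMZVConverges_cons_of_two_le hb τ (l := [(a, σ)]) (by simpa using ha))
  have hdiag := hasSum_signedPower_natCast_add_one (σ := τ * σ) (by omega : 1 ≤ b + a)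
    (ne_of_apply_ne Prod.fst (by omega))
  refine hasSum_symmetricIcc_of_hasSum_add_neg (by simp [signedPower_zero]) ?_
  refine (((hζ.mul_left x).mul_left (1 + (-1) ^ b)).sub
    (((hζ₂.mul_left 2).add hdiag).mul_left ((-1) ^ b))).congr_fun fun n => ?_
  rw [neg_neg, signedPowerPrimitive_neg, hsign, ← Nat.cast_succ, signedPowerPrimitive_natCast,
    altMHS_singleton_succ, Nat.cast_succ, signedPower_neg, ← signedPower_mul]
  ring

theorem altMZV_pair_mem {a b : ℕ} {σ τ : ℤˣ} (hab : Odd (a + b)) (ha : 1 ≤ a)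
    (haσ : (a, σ) ≠ (1, 1)) (hb : 2 ≤ b) : altMZV [(b, τ), (a, σ)] ∈ altZetaAlgebra := by
  have hbτ : (b, τ) ≠ (1, 1) := ne_of_apply_ne Prod.fst (by omega)
  have hconv := altMZVConverges_singleton ha haσ
  obtain ⟨B, hB⟩ := exists_abs_signedPowerPrimitive_le hconv
  obtain ⟨g, hg, x, hx, hgx⟩ := exists_hasSum_tornheim a b 0 σ τ 1 (by omega) (by omega)
    (by simpa using haσ) (by omega) (by simpa using hbτ)
  have hgx' : HasSum g x (conditional ℕ) := hgx.congr_fun fun n => by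
    simp [signedPower_natCast_add_one]
  have key := hgx'.unique (hasSum_conditional_nat_of_hasSum_primitive_mul
    (signedPowerPrimitive_add_one a σ) hB (tendsto_signedPowerPrimitive hconv)
    (summable_signedPower hb τ) hg (hasSum_sub_signedPowerPrimitive_mul hab ha hb σ τ _))
  have hε : (-1 : ℝ) ^ b * (-1) ^ b = 1 := by rw [← mul_pow, neg_one_mul, neg_neg, one_pow]
  have hεmem : (-1 : ℝ) ^ b ∈ altZetaAlgebra := pow_mem (neg_mem (one_mem _)) b
  have hsolve : altMZV [(b, τ), (a, σ)] = (1 / 2 : ℚ) • ((-1) ^ b *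
      ((1 + (-1) ^ b) * (altMZV [(a, σ)] * altMZV [(b, τ)]) - x) - altMZV [(b + a, τ * σ)]) := by
    rw [key, Rat.smul_def]
    push_cast
    linear_combination -1 / 2 * (2 * altMZV [(b, τ), (a, σ)] + altMZV [(b + a, τ * σ)]) * hε
  rw [hsolve]
  exact Subalgebra.smul_mem _ (sub_mem (mul_mem hεmem (sub_mem (mul_mem
    (add_mem (one_mem _) hεmem) (mul_mem (altMZV_singleton_mem ha haσ)
      (altMZV_singleton_mem (by omega) hbτ))) hx))
    (altMZV_singleton_mem (by omega) (ne_of_apply_ne Prod.fst (by omega)))) _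

end Parity

section Reduction

lemma tendsto_eulerPartialSum_singleton {s q : ℕ} {σ τ : ℤˣ}
    (h₁ : AltMZVConverges [(q, τ), (s, σ)]) (h₂ : AltMZVConverges [(q + s, σ * τ)]) :
    Tendsto (eulerPartialSum [(s, σ)] q τ) atTop
      (𝓝 (((σ * τ : ℤˣ) : ℤ) * (altMZV [(q, τ), (s, σ)] + altMZV [(q + s, σ * τ)]))) :=
  ((h₁.tendsto.add h₂.tendsto).const_mul _).congr
    fun n => (eulerPartialSum_singleton s q σ τ n).symm

lemma tendsto_eulerPartialSum_pair {a b q : ℕ} {σ₁ σ₂ σ₃ : ℤˣ}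
    (h₁ : AltMZVConverges [(q, σ₃), (a + b, σ₁ * σ₂)])
    (h₂ : AltMZVConverges [(q + a + b, σ₁ * σ₂ * σ₃)])
    (h₃ : AltMZVConverges [(q, σ₃), (a, σ₁), (b, σ₂)])
    (h₄ : AltMZVConverges [(q + a, σ₁ * σ₃), (b, σ₂)])
    (h₅ : AltMZVConverges [(q, σ₃), (b, σ₂), (a, σ₁)])
    (h₆ : AltMZVConverges [(q + b, σ₂ * σ₃), (a, σ₁)]) :
    Tendsto (eulerPartialSum [(a, σ₁), (b, σ₂)] q σ₃) atTop
      (𝓝 (((σ₁ * σ₂ * σ₃ : ℤˣ) : ℤ) *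
        (altMZV [(q, σ₃), (a + b, σ₁ * σ₂)] + altMZV [(q + a + b, σ₁ * σ₂ * σ₃)]
          + altMZV [(q, σ₃), (a, σ₁), (b, σ₂)] + altMZV [(q + a, σ₁ * σ₃), (b, σ₂)]
          + altMZV [(q, σ₃), (b, σ₂), (a, σ₁)] + altMZV [(q + b, σ₂ * σ₃), (a, σ₁)]))) :=
  ((((((h₁.tendsto.add h₂.tendsto).add h₃.tendsto).add h₄.tendsto).add h₅.tendsto).add
    h₆.tendsto).const_mul _).congr fun n => (eulerPartialSum_pair a b q σ₁ σ₂ σ₃ n).symm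

lemma tendsto_eulerPartialSum_cube {r : ℕ} {σ : ℤˣ} (h₁ : EulerSumConverges [(r, σ)] (2 * r) 1)
    (h₂ : AltMZVConverges [(r, σ)]) (h₃ : AltMZVConverges [(3 * r, σ)]) :
    Tendsto (eulerPartialSum [(r, σ), (r, σ)] r σ) atTop
      (𝓝 (eulerSum [(r, σ)] (2 * r) 1
        + (σ : ℤ) / 3 * (altMZV [(r, σ)] ^ 3 - altMZV [(3 * r, σ)]))) :=
  ((tendsto_nhds_limUnder h₁).add (((h₂.tendsto.pow 3).sub h₃.tendsto).const_mul _)).congr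
    fun n => (eulerPartialSum_cube r σ n).symm

lemma eulerSumConverges_singleton {s q : ℕ} (hs : 1 ≤ s) (hq : 2 ≤ q) (σ τ : ℤˣ) :
    EulerSumConverges [(s, σ)] q τ :=
  ⟨_, tendsto_eulerPartialSum_singleton (altMZVConverges_cons_of_two_le hq τ (by simpa using hs))
    (altMZVConverges_cons_of_two_le (by omega) _ (List.forall_mem_nil _))⟩

theorem eulerSum_singleton_mem {s q : ℕ} {σ τ : ℤˣ} (hsq : Odd (s + q)) (hs : 1 ≤ s)
    (hsσ : (s, σ) ≠ (1, 1)) (hq : 2 ≤ q) : eulerSum [(s, σ)] q τ ∈ altZetaAlgebra := by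
  have hqs : (q + s, σ * τ) ≠ (1, 1) := ne_of_apply_ne Prod.fst (by omega)
  rw [eulerSum, (tendsto_eulerPartialSum_singleton
    (altMZVConverges_cons_of_two_le hq τ (by simpa using hs))
    (altMZVConverges_singleton (by omega) hqs)).limUnder_eq]
  exact mul_mem (intCast_mem _ _)
    (add_mem (altMZV_pair_mem hsq hs hsσ hq) (altMZV_singleton_mem (by omega) hqs))

theorem eulerSum_cube_mem {r : ℕ} {σ : ℤˣ} (hr : Odd r) (hrσ : (r, σ) ≠ (1, 1)) :
    eulerSum [(r, σ), (r, σ)] r σ ∈ altZetaAlgebra := by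
  have hr1 : 1 ≤ r := hr.pos
  have h3r : (3 * r, σ) ≠ (1, 1) := ne_of_apply_ne Prod.fst (by omega)
  have hσ : ((σ : ℤ) : ℝ) / 3 ∈ altZetaAlgebra := by
    simpa using algebraMap_mem altZetaAlgebra ((σ : ℤ) / 3 : ℚ)
  rw [eulerSum, (tendsto_eulerPartialSum_cube (eulerSumConverges_singleton hr1 (by omega) σ 1)
    (altMZVConverges_singleton hr1 hrσ) (altMZVConverges_singleton (by omega) h3r)).limUnder_eq]
  exact add_mem (eulerSum_singleton_mem (by grind) hr1 hrσ (by omega))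
    (mul_mem hσ (sub_mem (pow_mem (altMZV_singleton_mem hr1 hrσ) 3)
      (altMZV_singleton_mem (by omega) h3r)))

end Reduction

end EulerSums

theorem mainTheorem12 :
    -- every (alternating) quadratic Euler sum in terms of six alternating MZVs
    (∀ (i₁ i₂ q : ℕ) (σ₁ σ₂ σ₃ : ℤˣ), 1 ≤ i₁ → 1 ≤ i₂ → 1 ≤ q → (q, σ₃) ≠ (1, 1) →
      EulerSumConverges [(i₁, σ₁), (i₂, σ₂)] q σ₃ ∧
      AltMZVConverges [(q, σ₃), (i₁ + i₂, σ₁ * σ₂)] ∧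
      AltMZVConverges [(q + i₁ + i₂, σ₁ * σ₂ * σ₃)] ∧
      AltMZVConverges [(q, σ₃), (i₁, σ₁), (i₂, σ₂)] ∧
      AltMZVConverges [(q + i₁, σ₁ * σ₃), (i₂, σ₂)] ∧
      AltMZVConverges [(q, σ₃), (i₂, σ₂), (i₁, σ₁)] ∧
      AltMZVConverges [(q + i₂, σ₂ * σ₃), (i₁, σ₁)] ∧
      eulerSum [(i₁, σ₁), (i₂, σ₂)] q σ₃ =
        ((σ₁ * σ₂ * σ₃ : ℤˣ) : ℤ) *
          (altMZV [(q, σ₃), (i₁ + i₂, σ₁ * σ₂)] + altMZV [(q + i₁ + i₂, σ₁ * σ₂ * σ₃)]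
            + altMZV [(q, σ₃), (i₁, σ₁), (i₂, σ₂)] + altMZV [(q + i₁, σ₁ * σ₃), (i₂, σ₂)]
            + altMZV [(q, σ₃), (i₂, σ₂), (i₁, σ₁)] + altMZV [(q + i₂, σ₂ * σ₃), (i₁, σ₁)])) ∧
    -- the reduction of the sums with three equal barred exponents
    (∀ r : ℕ, 1 ≤ r →
      EulerSumConverges [(r, -1), (r, -1)] r (-1) ∧
      EulerSumConverges [(r, -1)] (2 * r) 1 ∧
      AltMZVConverges [(3 * r, -1)] ∧
      AltMZVConverges [(r, -1)] ∧
      eulerSum [(r, -1), (r, -1)] r (-1) =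
        eulerSum [(r, -1)] (2 * r) 1
          + 1 / 3 * (altMZV [(3 * r, -1)] - altMZV [(r, -1)] ^ 3)) ∧
    -- for odd exponents these are rational polynomials in (alternating) zeta values
    (∀ r : ℕ, Odd r →
      eulerSum [(r, -1), (r, -1)] r (-1) ∈ Algebra.adjoin ℚ altZetaValues) := by
  refine ⟨fun i₁ i₂ q σ₁ σ₂ σ₃ h₁ h₂ hq hqσ => ?_, fun r hr => ?_,
    fun r hr => eulerSum_cube_mem hr (by simp)⟩
  · have hζ₁ : AltMZVConverges [(q, σ₃), (i₁ + i₂, σ₁ * σ₂)] :=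
      altMZVConverges_cons hq hqσ (by simp; omega)
    have hζ₂ : AltMZVConverges [(q + i₁ + i₂, σ₁ * σ₂ * σ₃)] :=
      altMZVConverges_cons_of_two_le (by omega) _ (by simp)
    have hζ₃ : AltMZVConverges [(q, σ₃), (i₁, σ₁), (i₂, σ₂)] :=
      altMZVConverges_cons hq hqσ (by simp [h₁, h₂])
    have hζ₄ : AltMZVConverges [(q + i₁, σ₁ * σ₃), (i₂, σ₂)] :=
      altMZVConverges_cons_of_two_le (by omega) _ (by simpa using h₂)
    have hζ₅ : AltMZVConverges [(q, σ₃), (i₂, σ₂), (i₁, σ₁)] :=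
      altMZVConverges_cons hq hqσ (by simp [h₁, h₂])
    have hζ₆ : AltMZVConverges [(q + i₂, σ₂ * σ₃), (i₁, σ₁)] :=
      altMZVConverges_cons_of_two_le (by omega) _ (by simpa using h₁)
    have hS := tendsto_eulerPartialSum_pair hζ₁ hζ₂ hζ₃ hζ₄ hζ₅ hζ₆
    exact ⟨⟨_, hS⟩, hζ₁, hζ₂, hζ₃, hζ₄, hζ₅, hζ₆, hS.limUnder_eq⟩
  · have hlin := eulerSumConverges_singleton hr (by omega : 2 ≤ 2 * r) (-1) 1
    have hζ := altMZVConverges_singleton hr (by simp : (r, (-1 : ℤˣ)) ≠ (1, 1))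
    have hζ₃ := altMZVConverges_cons_of_two_le (by omega : 2 ≤ 3 * r) (-1) (List.forall_mem_nil _)
    have hcube := tendsto_eulerPartialSum_cube hlin hζ hζ₃
    exact ⟨⟨_, hcube⟩, hlin, hζ₃, hζ, hcube.limUnder_eq.trans (by push_cast; ring)⟩
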